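/- Whipple's summation formula (general, possibly non-terminating case). For $x\in\mathbb{C}$ and $n\in\mathbb{Z}_{\ge 0}$ let $(x)_n=x(x+1)\cdots(x+n-1)$, $(x)_0=1$. Let $a,b,c\in\mathbb{C}$ with $\operatorname{Re}(b+c)>1$, and suppose that neither $b$ nor $c$ is one of the integers $0,-1,-2,\dots$. Then the series $$ {}_3F_2\!\left({a,\;1-a,\;\tfrac{b+c-1}{2}\atop b,\;c};\,1\right)=\sum_{n=0}^{\infty}\frac{(a)_n\,(1-a)_n\,\left(\tfrac{b+c-1}{2}\right)_n}{n!\,(b)_n\,(c)_n} $$ converges absolutely, and its sum equals $$ \frac{4\pi\cdot 2^{-(b+c)}\,\Gamma(b)\,\Gamma(c)}{\Gamma\!\left(\frac{b+a}{2}\right)\Gamma\!\left(\frac{b+1-a}{2}\right)\Gamma\!\left(\frac{c+a}{2}\right)\Gamma\!\left(\frac{c+1-a}{2}\right)}, $$ where $1/\Gamma$ is understood as the entire function that vanishes at $0,-1,-2,\dots$. -/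

import Mathlib

/-- The `n`-th term `(a₁)ₙ⋯(aₚ)ₙ / (n! (b₁)ₙ⋯(b_q)ₙ) * zⁿ` of the generalized hypergeometric series
with upper parameters `as` and lower parameters `bs`; here `(a)ₙ = a (a + 1) ⋯ (a + n - 1)` is the
rising factorial, i.e. the value at `a` of `ascPochhammer ℂ n`. -/
noncomputable def hypergeometricTerm (as bs : List ℂ) (z : ℂ) (n : ℕ) : ℂ :=
  (as.map fun a => (ascPochhammer ℂ n).eval a).prod /
    ((n.factorial : ℂ) * (bs.map fun b => (ascPochhammer ℂ n).eval b).prod) * z ^ n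

/-- The sum of the generalized hypergeometric series `ₚF_q(as; bs; z)`. -/
noncomputable def generalizedHypergeometric (as bs : List ℂ) (z : ℂ) : ℂ :=
  ∑' n : ℕ, hypergeometricTerm as bs z n

open Filter Topology Complex

/-! Write S(b,c) for the sum and s = (b+c-1)/2. A telescoping certificate relates S(b,c) to S(b+2,c)
by a rational factor (`tsum_whippleTerm_add_two`), and the symmetry in b and c gives the same for c.
Iterating N times in both parameters, S(b,c) = F_N(b) F_N(c) S(b+2N,c+2N), with F_N a quotient of
Pochhammer symbols. As N → ∞ the last sum tends to 1, its constant term, by dominated convergence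
(`tendsto_tsum_whippleTerm_add`). Euler's limit and Legendre duplication evaluate lim F_N
(`tendsto_whippleFactor`). The product of the two limits is the formula. -/

/-- The terms of Whipple's series, with the third upper parameter `(b + c - 1) / 2`. -/
noncomputable def whippleTerm (a b c : ℂ) (n : ℕ) : ℂ :=
  (ascPochhammer ℂ n).eval a * (ascPochhammer ℂ n).eval (1 - a) *
      (ascPochhammer ℂ n).eval ((b + c - 1) / 2) /
    ((n.factorial : ℂ) * ((ascPochhammer ℂ n).eval b * (ascPochhammer ℂ n).eval c))

theorem hypergeometricTerm_eq_whippleTerm (a b c : ℂ) :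
    hypergeometricTerm [a, 1 - a, (b + c - 1) / 2] [b, c] 1 = whippleTerm a b c := by
  funext n
  simp [hypergeometricTerm, whippleTerm, mul_assoc]

theorem whippleTerm_comm (a b c : ℂ) : whippleTerm a b c = whippleTerm a c b := by
  funext n
  rw [whippleTerm, whippleTerm, add_comm b c,
    mul_comm ((ascPochhammer ℂ n).eval b) ((ascPochhammer ℂ n).eval c)]

/-! ### Pochhammer symbols and Euler's limit for 1/Γ -/

theorem eval_ascPochhammer_eq_prod_range (n : ℕ) (x : ℂ) :
    (ascPochhammer ℂ n).eval x = ∏ j ∈ Finset.range n, (x + j) := by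
  induction n with
  | zero => simp
  | succ n ih => rw [ascPochhammer_succ_eval, ih, Finset.prod_range_succ]

theorem eval_ascPochhammer_ne_zero {x : ℂ} (hx : ∀ k : ℕ, x ≠ -(k : ℂ)) (n : ℕ) :
    (ascPochhammer ℂ n).eval x ≠ 0 := by
  rw [eval_ascPochhammer_eq_prod_range, Finset.prod_ne_zero_iff]
  exact fun k _ h => hx k (eq_neg_of_add_eq_zero_left h)

theorem mul_eval_ascPochhammer_add_one (n : ℕ) (x : ℂ) :
    x * (ascPochhammer ℂ n).eval (x + 1) = (ascPochhammer ℂ n).eval x * (x + n) := by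
  induction n with
  | zero => simp
  | succ n ih =>
    rw [ascPochhammer_succ_eval, ascPochhammer_succ_eval, ← mul_assoc, ih]
    push_cast
    ring

theorem eval_ascPochhammer_succ_eq_inv_GammaSeq (x : ℂ) {n : ℕ} (hn : n ≠ 0) :
    (ascPochhammer ℂ (n + 1)).eval x = (n : ℂ) ^ x * n.factorial * (GammaSeq x n)⁻¹ := by
  have h1 : (n : ℂ) ^ x ≠ 0 := by simp [cpow_eq_zero_iff, hn]
  have h2 : (n.factorial : ℂ) ≠ 0 := by exact_mod_cast n.factorial_ne_zero
  rw [eval_ascPochhammer_eq_prod_range, GammaSeq, inv_div]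
  field_simp

/-- Passing to inverses covers the poles: at x = -k the product is 0 for n ≥ k, and division by zero
makes both `GammaSeq` and `Gamma` equal to 0, as is the inverse. -/
theorem tendsto_inv_GammaSeq (x : ℂ) :
    Tendsto (fun n => (GammaSeq x n)⁻¹) atTop (𝓝 (Gamma x)⁻¹) := by
  by_cases hx : ∀ k : ℕ, x ≠ -(k : ℂ)
  · exact (GammaSeq_tendsto_Gamma x).inv₀ (Gamma_ne_zero hx)
  · push Not at hx
    obtain ⟨k, rfl⟩ := hx
    rw [Gamma_neg_nat_eq_zero, inv_zero]
    refine tendsto_const_nhds.congr' ?_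
    filter_upwards [eventually_ge_atTop k] with n hn
    have : ∏ j ∈ Finset.range (n + 1), (-(k : ℂ) + j) = 0 :=
      Finset.prod_eq_zero (Finset.mem_range.2 (Nat.lt_succ_of_le hn)) (by simp)
    simp [GammaSeq, this]

/-! ### Decay of the terms and absolute convergence -/

/-- Up to a convergent factor, the `(n + 1)`-st term is `n ^ (-s) / (n + 1)` with
`s = (b + c - 1) / 2`. -/
theorem exists_tendsto_whippleTerm_succ (a b c : ℂ)
    (hb : ∀ k : ℕ, b ≠ -(k : ℂ)) (hc : ∀ k : ℕ, c ≠ -(k : ℂ)) :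
    ∃ (u : ℕ → ℂ) (l : ℂ), Tendsto u atTop (𝓝 l) ∧ ∀ n : ℕ, n ≠ 0 →
      whippleTerm a b c (n + 1) = u n * ((n : ℂ) ^ (-((b + c - 1) / 2)) / ((n : ℂ) + 1)) := by
  refine ⟨fun n => (GammaSeq a n)⁻¹ * (GammaSeq (1 - a) n)⁻¹ *
      (GammaSeq ((b + c - 1) / 2) n)⁻¹ * (GammaSeq b n)⁻¹⁻¹ * (GammaSeq c n)⁻¹⁻¹, _,
    ((((tendsto_inv_GammaSeq a).mul (tendsto_inv_GammaSeq _)).mul (tendsto_inv_GammaSeq _)).mul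
      ((tendsto_inv_GammaSeq b).inv₀ (inv_ne_zero (Gamma_ne_zero hb)))).mul
      ((tendsto_inv_GammaSeq c).inv₀ (inv_ne_zero (Gamma_ne_zero hc))), fun n hn => ?_⟩
  have hn' : (n : ℂ) ≠ 0 := Nat.cast_ne_zero.2 hn
  have hf : (n.factorial : ℂ) ≠ 0 := by exact_mod_cast n.factorial_ne_zero
  have hn1 : (n : ℂ) + 1 ≠ 0 := by exact_mod_cast n.succ_ne_zero
  -- The exponents balance because b + c = 2s + 1.
  have hpow : (n : ℂ) ^ a * (n : ℂ) ^ (1 - a) * (n : ℂ) ^ ((b + c - 1) / 2) =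
      (n : ℂ) ^ (-((b + c - 1) / 2)) * ((n : ℂ) ^ b * (n : ℂ) ^ c) := by
    simp only [← cpow_add _ _ hn']
    congr 1
    ring
  have hb0 : (n : ℂ) ^ b ≠ 0 := by simp [cpow_eq_zero_iff, hn]
  have hc0 : (n : ℂ) ^ c ≠ 0 := by simp [cpow_eq_zero_iff, hn]
  have key : ∀ A B C D E p q r s t v f m : ℂ, f ≠ 0 → m ≠ 0 → s ≠ 0 → t ≠ 0 →
      p * q * r = v * (s * t) →
      p * f * A * (q * f * B) * (r * f * C) / (m * f * (s * f * D * (t * f * E))) =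
        A * B * C * D⁻¹ * E⁻¹ * (v / m) := by
    intro A B C D E p q r s t v f m hf hm hs ht h
    have : p * f * A * (q * f * B) * (r * f * C) = v * (s * t) * (f ^ 3 * (A * B * C)) := by
      rw [← h]; ring
    rw [this, div_eq_mul_inv, div_eq_mul_inv]
    simp only [mul_inv]
    field_simp
  simp only [whippleTerm, eval_ascPochhammer_succ_eq_inv_GammaSeq _ hn, Nat.factorial_succ,
    Nat.cast_mul, Nat.cast_add, Nat.cast_one]
  exact key _ _ _ _ _ _ _ _ _ _ _ _ _ hf hn1 hb0 hc0 hpow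

theorem summable_whippleTerm (a b c : ℂ) (hbc : 1 < (b + c).re)
    (hb : ∀ k : ℕ, b ≠ -(k : ℂ)) (hc : ∀ k : ℕ, c ≠ -(k : ℂ)) :
    Summable (whippleTerm a b c) := by
  obtain ⟨u, l, hu, h⟩ := exists_tendsto_whippleTerm_succ a b c hb hc
  rw [← summable_nat_add_iff 1]
  set σ : ℝ := ((b + c).re - 1) / 2 with hσ
  have hs : (-((b + c - 1) / 2)).re = -σ := by simp [hσ]
  refine summable_of_isBigO_nat (g := fun n : ℕ => (n : ℝ) ^ (-σ - 1))
    (Real.summable_nat_rpow.2 (by linarith)) ?_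
  have h1 : (fun n : ℕ => (n : ℂ) ^ (-((b + c - 1) / 2)) / ((n : ℂ) + 1)) =O[atTop]
      fun n : ℕ => (n : ℝ) ^ (-σ - 1) := by
    refine Asymptotics.IsBigO.of_bound 1 ?_
    filter_upwards [eventually_gt_atTop 0] with n hn
    have hn' : (0 : ℝ) < n := Nat.cast_pos.2 hn
    rw [norm_div, norm_natCast_cpow_of_pos hn, hs, one_mul,
      Real.norm_of_nonneg (Real.rpow_nonneg hn'.le _), Real.rpow_sub_one hn'.ne']
    have : ‖(n : ℂ) + 1‖ = n + 1 := by exact_mod_cast norm_natCast (n + 1)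
    rw [this]
    gcongr
    linarith
  have h2 := hu.isBigO_one ℝ |>.mul h1
  simp only [one_mul] at h2
  refine h2.congr' ?_ EventuallyEq.rfl
  filter_upwards [eventually_ne_atTop 0] with n hn using (h n hn).symm

theorem tendsto_succ_mul_whippleTerm_succ (a b c : ℂ) (hbc : 1 < (b + c).re)
    (hb : ∀ k : ℕ, b ≠ -(k : ℂ)) (hc : ∀ k : ℕ, c ≠ -(k : ℂ)) :
    Tendsto (fun n : ℕ => ((n : ℂ) + 1) * whippleTerm a b c (n + 1)) atTop (𝓝 0) := by
  obtain ⟨u, l, hu, h⟩ := exists_tendsto_whippleTerm_succ a b c hb hc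
  have hs : (-((b + c - 1) / 2)).re = -(((b + c).re - 1) / 2) := by simp
  have h0 : Tendsto (fun n : ℕ => (n : ℂ) ^ (-((b + c - 1) / 2))) atTop (𝓝 0) := by
    rw [tendsto_zero_iff_norm_tendsto_zero]
    refine ((tendsto_rpow_neg_atTop (y := ((b + c).re - 1) / 2) (by linarith)).comp
      tendsto_natCast_atTop_atTop).congr' ?_
    filter_upwards [eventually_gt_atTop 0] with n hn
    rw [norm_natCast_cpow_of_pos hn, hs, Function.comp_apply]
  have h1 := hu.mul h0
  rw [mul_zero] at h1
  refine h1.congr' ?_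
  filter_upwards [eventually_ne_atTop 0] with n hn
  have hn1 : (n : ℂ) + 1 ≠ 0 := by exact_mod_cast n.succ_ne_zero
  rw [h n hn]
  field_simp

/-! ### The recurrence b → b + 2 -/

theorem ne_neg_natCast_add_natCast {b : ℂ} (hb : ∀ k : ℕ, b ≠ -(k : ℂ)) (m k : ℕ) :
    b + m ≠ -(k : ℂ) := by
  intro h
  refine hb (k + m) ?_
  push_cast
  linear_combination h

theorem ne_neg_natCast_add_two {b : ℂ} (hb : ∀ k : ℕ, b ≠ -(k : ℂ)) (k : ℕ) :
    b + 2 ≠ -(k : ℂ) := by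
  exact_mod_cast ne_neg_natCast_add_natCast hb 2 k

/-- The telescoping identity behind the recurrence of the sum in the lower parameter `b`. -/
theorem whippleTerm_add_two_sub (a b c : ℂ) (hbc : 1 < (b + c).re)
    (hb : ∀ k : ℕ, b ≠ -(k : ℂ)) (hc : ∀ k : ℕ, c ≠ -(k : ℂ)) (n : ℕ) :
    (b + a) * (b + (1 - a)) / (b * (b + 1)) * whippleTerm a (b + 2) c n - whippleTerm a b c n =
      ((n + 1 : ℕ) : ℂ) * (c + (n + 1 : ℕ) - 1) / ((b + c - 1) / 2 * (b + (n + 1 : ℕ))) *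
          whippleTerm a b c (n + 1) -
        (n : ℂ) * (c + n - 1) / ((b + c - 1) / 2 * (b + n)) * whippleTerm a b c n := by
  obtain ⟨s, hs⟩ : ∃ s, s = (b + c - 1) / 2 := ⟨_, rfl⟩
  have hs0 : s ≠ 0 := by
    intro h
    have : (b + c).re = 1 := by
      have h' : b + c = 1 := by linear_combination 2 * hs.symm.trans h
      rw [h', one_re]
    linarith
  have hs2 : (b + 2 + c - 1) / 2 = s + 1 := by rw [hs]; ring
  have hcs : c = 2 * s + 1 - b := by rw [hs]; ring
  have hb0 : b ≠ 0 := by simpa using hb 0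
  have hb1 : b + 1 ≠ 0 := fun h => hb 1 (by push_cast; linear_combination h)
  have hbn : b + n ≠ 0 := fun h => hb n (by linear_combination h)
  have hbn1 : b + n + 1 ≠ 0 := fun h => hb (n + 1) (by push_cast; linear_combination h)
  have hcn : c + n ≠ 0 := fun h => hc n (by linear_combination h)
  have hn1 : (n : ℂ) + 1 ≠ 0 := by exact_mod_cast n.succ_ne_zero
  have hf : (n.factorial : ℂ) ≠ 0 := by exact_mod_cast n.factorial_ne_zero
  have hPb := eval_ascPochhammer_ne_zero hb n
  have hPc := eval_ascPochhammer_ne_zero hc n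
  have e1 : (ascPochhammer ℂ n).eval (s + 1) = (ascPochhammer ℂ n).eval s * (s + n) / s := by
    rw [← mul_eval_ascPochhammer_add_one]
    field_simp
  have e2 : (ascPochhammer ℂ n).eval (b + 2) =
      (ascPochhammer ℂ n).eval b * (b + n) * (b + n + 1) / (b * (b + 1)) := by
    rw [← mul_eval_ascPochhammer_add_one, eq_div_iff (mul_ne_zero hb0 hb1)]
    have := mul_eval_ascPochhammer_add_one n (b + 1)
    rw [show b + 1 + 1 = b + 2 by ring] at this
    linear_combination b * this
  simp only [whippleTerm, hs2, ← hs, e1, e2, ascPochhammer_succ_eval, Nat.factorial_succ,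
    Nat.cast_mul, Nat.cast_add, Nat.cast_one]
  generalize (ascPochhammer ℂ n).eval a = A
  generalize (ascPochhammer ℂ n).eval (1 - a) = A'
  generalize (ascPochhammer ℂ n).eval s = S
  generalize (ascPochhammer ℂ n).eval b = B at *
  generalize (ascPochhammer ℂ n).eval c = C at *
  generalize (n.factorial : ℂ) = f at *
  generalize (n : ℂ) = x at *
  have hbn1' : b + (x + 1) ≠ 0 := by rwa [← add_assoc]
  -- The identity divided by the n-th term: a rational identity once c = 2s + 1 - b is substituted.
  have key : (b + a) * (b + (1 - a)) * (s + x) / (s * ((b + x) * (b + x + 1))) - 1 =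
      (a + x) * (1 - a + x) * (s + x) / (s * ((b + x) * (b + x + 1))) -
        x * (c + x - 1) / (s * (b + x)) := by
    field_simp
    rw [hcs]
    ring
  have l1 : (b + a) * (b + (1 - a)) / (b * (b + 1)) *
      (A * A' * (S * (s + x) / s) / (f * (B * (b + x) * (b + x + 1) / (b * (b + 1)) * C))) =
      A * A' * S / (f * (B * C)) *
        ((b + a) * (b + (1 - a)) * (s + x) / (s * ((b + x) * (b + x + 1)))) := by
    field_simp
  have l2 : (x + 1) * (c + (x + 1) - 1) / (s * (b + (x + 1))) *
      (A * (a + x) * (A' * (1 - a + x)) * (S * (s + x)) /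
        ((x + 1) * f * (B * (b + x) * (C * (c + x))))) =
      A * A' * S / (f * (B * C)) *
        ((a + x) * (1 - a + x) * (s + x) / (s * ((b + x) * (b + x + 1)))) := by
    rw [show c + (x + 1) - 1 = c + x by ring, ← add_assoc b x 1]
    field_simp
  rw [l1, l2]
  linear_combination A * A' * S / (f * (B * C)) * key

theorem tsum_whippleTerm_add_two (a b c : ℂ) (hbc : 1 < (b + c).re)
    (hb : ∀ k : ℕ, b ≠ -(k : ℂ)) (hc : ∀ k : ℕ, c ≠ -(k : ℂ)) :
    ∑' n, whippleTerm a b c n =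
      (b + a) * (b + (1 - a)) / (b * (b + 1)) * ∑' n, whippleTerm a (b + 2) c n := by
  have hbc2 : 1 < (b + 2 + c).re := by
    simp only [add_re, re_ofNat] at hbc ⊢
    linarith
  have h1 := (summable_whippleTerm a b c hbc hb hc).hasSum.tendsto_sum_nat
  have h2 := ((summable_whippleTerm a (b + 2) c hbc2 (ne_neg_natCast_add_two hb)
    hc).hasSum.tendsto_sum_nat).const_mul ((b + a) * (b + (1 - a)) / (b * (b + 1)))
  have h3 := h2.sub h1
  set G : ℕ → ℂ := fun n =>
    (n : ℂ) * (c + n - 1) / ((b + c - 1) / 2 * (b + n)) * whippleTerm a b c n with hG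
  have h4 : ∀ N : ℕ, (b + a) * (b + (1 - a)) / (b * (b + 1)) *
      ∑ n ∈ Finset.range N, whippleTerm a (b + 2) c n -
      ∑ n ∈ Finset.range N, whippleTerm a b c n = G N := by
    intro N
    rw [Finset.mul_sum, ← Finset.sum_sub_distrib]
    simp_rw [whippleTerm_add_two_sub a b c hbc hb hc]
    rw [Finset.sum_range_sub G]
    simp [hG]
  -- The boundary term vanishes: n times the n-th term tends to 0, and the remaining ratio is
  -- bounded.
  have h5 : Tendsto G atTop (𝓝 0) := by
    rw [← tendsto_add_atTop_iff_nat 1]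
    have hr : Tendsto (fun n : ℕ => (c + n) / (b + 1 + n)) atTop (𝓝 1) := by
      have t1 := (tendsto_natCast_div_add_atTop (𝕜 := ℂ) (b + 1))
      have t2 : Tendsto (fun n : ℕ => ((n : ℂ) + (b + 1))⁻¹) atTop (𝓝 0) :=
        tendsto_inv₀_cobounded.comp ((tendsto_add_const_cobounded (b + 1)).comp
          (tendsto_norm_atTop_iff_cobounded.1 (by simpa using tendsto_natCast_atTop_atTop)))
      have t3 := t1.add (t2.const_mul c)
      simp only [mul_zero, add_zero] at t3
      refine t3.congr fun n => ?_
      rw [add_comm (b + 1) (n : ℂ), add_comm c (n : ℂ), add_div, div_eq_mul_inv c]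
    have t := ((tendsto_succ_mul_whippleTerm_succ a b c hbc hb hc).mul hr).const_mul
      ((b + c - 1) / 2)⁻¹
    simp only [zero_mul, mul_zero] at t
    refine t.congr fun n => ?_
    simp only [hG, Nat.cast_add, Nat.cast_one]
    rw [show c + ((n : ℂ) + 1) - 1 = c + n by ring, show b + ((n : ℂ) + 1) = b + 1 + n by ring]
    simp only [div_eq_mul_inv, mul_inv]
    ring
  have h6 := tendsto_nhds_unique (h3.congr h4) h5
  exact (sub_eq_zero.1 h6).symm

theorem tsum_whippleTerm_add_two_add_two (a b c : ℂ) (hbc : 1 < (b + c).re)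
    (hb : ∀ k : ℕ, b ≠ -(k : ℂ)) (hc : ∀ k : ℕ, c ≠ -(k : ℂ)) :
    ∑' n, whippleTerm a b c n =
      (b + a) * (b + (1 - a)) / (b * (b + 1)) * ((c + a) * (c + (1 - a)) / (c * (c + 1))) *
        ∑' n, whippleTerm a (b + 2) (c + 2) n := by
  have hbc2 : 1 < (c + (b + 2)).re := by
    simp only [add_re, re_ofNat] at hbc ⊢
    linarith
  rw [tsum_whippleTerm_add_two a b c hbc hb hc, whippleTerm_comm a (b + 2) c,
    tsum_whippleTerm_add_two a c (b + 2) hbc2 hc (ne_neg_natCast_add_two hb),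
    whippleTerm_comm a (c + 2) (b + 2), mul_assoc]

/-! ### Iteration and the limit of the factors -/

/-- The factor picked up when one lower parameter of Whipple's series is raised by `2 * N`. -/
noncomputable def whippleFactor (a b : ℂ) (N : ℕ) : ℂ :=
  (ascPochhammer ℂ N).eval ((b + a) / 2) * (ascPochhammer ℂ N).eval ((b + (1 - a)) / 2) /
    ((ascPochhammer ℂ N).eval (b / 2) * (ascPochhammer ℂ N).eval (b / 2 + 1 / 2))

theorem whippleFactor_succ (a b : ℂ) (N : ℕ) :
    whippleFactor a b (N + 1) = whippleFactor a b N *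
      ((b + 2 * N + a) * (b + 2 * N + (1 - a)) / ((b + 2 * N) * (b + 2 * N + 1))) := by
  simp only [whippleFactor, ascPochhammer_succ_eval]
  rw [show (b + a) / 2 + N = (b + 2 * N + a) / 2 by ring,
    show (b + (1 - a)) / 2 + N = (b + 2 * N + (1 - a)) / 2 by ring,
    show b / 2 + (N : ℂ) = (b + 2 * N) / 2 by ring,
    show b / 2 + 1 / 2 + (N : ℂ) = (b + 2 * N + 1) / 2 by ring]
  simp only [div_eq_mul_inv, mul_inv, inv_inv]
  ring

theorem tsum_whippleTerm_eq_mul (a b c : ℂ) (hbc : 1 < (b + c).re)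
    (hb : ∀ k : ℕ, b ≠ -(k : ℂ)) (hc : ∀ k : ℕ, c ≠ -(k : ℂ)) (N : ℕ) :
    ∑' n, whippleTerm a b c n = whippleFactor a b N * whippleFactor a c N *
      ∑' n, whippleTerm a (b + 2 * N) (c + 2 * N) n := by
  induction N with
  | zero => simp [whippleFactor]
  | succ N ih =>
    have hN : (0 : ℝ) ≤ N := N.cast_nonneg
    have hbc2 : 1 < (b + 2 * N + (c + 2 * N)).re := by
      simp only [add_re, mul_re, re_ofNat, im_ofNat, natCast_re, natCast_im] at hbc ⊢
      linarith
    have hb2 : ∀ k : ℕ, b + 2 * N ≠ -(k : ℂ) := by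
      exact_mod_cast ne_neg_natCast_add_natCast hb (2 * N)
    have hc2 : ∀ k : ℕ, c + 2 * N ≠ -(k : ℂ) := by
      exact_mod_cast ne_neg_natCast_add_natCast hc (2 * N)
    rw [ih, tsum_whippleTerm_add_two_add_two a _ _ hbc2 hb2 hc2, whippleFactor_succ,
      whippleFactor_succ]
    push_cast
    rw [show b + 2 * ((N : ℂ) + 1) = b + 2 * N + 2 by ring,
      show c + 2 * ((N : ℂ) + 1) = c + 2 * N + 2 by ring]
    ring

/-- In Euler's limit the powers of n cancel, since both pairs of arguments sum to b + 1/2.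
Duplication rewrites Γ(b/2)Γ(b/2+1/2). -/
theorem tendsto_whippleFactor (a b : ℂ) (hb : ∀ k : ℕ, b ≠ -(k : ℂ)) :
    Tendsto (whippleFactor a b) atTop (𝓝 (Gamma b * (2 : ℂ) ^ (1 - b) * (√Real.pi : ℝ) /
      (Gamma ((b + a) / 2) * Gamma ((b + (1 - a)) / 2)))) := by
  have hdup := Gamma_mul_Gamma_add_half (b / 2)
  rw [show 2 * (b / 2) = b by ring] at hdup
  have h1 : ∀ k : ℕ, b / 2 ≠ -(k : ℂ) := fun k h =>
    hb (2 * k) (by push_cast; linear_combination 2 * h)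
  have h2 : ∀ k : ℕ, b / 2 + 1 / 2 ≠ -(k : ℂ) := fun k h =>
    hb (2 * k + 1) (by push_cast; linear_combination 2 * h)
  rw [← hdup, ← tendsto_add_atTop_iff_nat 1]
  have t := (((tendsto_inv_GammaSeq ((b + a) / 2)).mul
    (tendsto_inv_GammaSeq ((b + (1 - a)) / 2))).mul
      ((tendsto_inv_GammaSeq (b / 2)).inv₀ (inv_ne_zero (Gamma_ne_zero h1)))).mul
      ((tendsto_inv_GammaSeq (b / 2 + 1 / 2)).inv₀ (inv_ne_zero (Gamma_ne_zero h2)))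
  have hlim : Gamma (b / 2) * Gamma (b / 2 + 1 / 2) /
      (Gamma ((b + a) / 2) * Gamma ((b + (1 - a)) / 2)) =
      (Gamma ((b + a) / 2))⁻¹ * (Gamma ((b + (1 - a)) / 2))⁻¹ * (Gamma (b / 2))⁻¹⁻¹ *
        (Gamma (b / 2 + 1 / 2))⁻¹⁻¹ := by
    simp only [div_eq_mul_inv, mul_inv, inv_inv]
    ring
  rw [hlim]
  refine t.congr' ?_
  filter_upwards [eventually_ne_atTop 0] with n hn
  have hn' : (n : ℂ) ≠ 0 := Nat.cast_ne_zero.2 hn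
  have hf : (n.factorial : ℂ) ≠ 0 := by exact_mod_cast n.factorial_ne_zero
  have hpow : (n : ℂ) ^ ((b + a) / 2) * (n : ℂ) ^ ((b + (1 - a)) / 2) =
      (n : ℂ) ^ (b / 2) * (n : ℂ) ^ (b / 2 + 1 / 2) := by
    simp only [← cpow_add _ _ hn']
    congr 1
    ring
  have hp : (n : ℂ) ^ (b / 2) ≠ 0 := by simp [cpow_eq_zero_iff, hn]
  have hq : (n : ℂ) ^ (b / 2 + 1 / 2) ≠ 0 := by rw [Ne, cpow_eq_zero_iff]; simp [hn]
  simp only [whippleFactor, eval_ascPochhammer_succ_eq_inv_GammaSeq _ hn]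
  have key : ∀ A B D E p q s t f : ℂ, f ≠ 0 → s ≠ 0 → t ≠ 0 → p * q = s * t →
      A * B * D⁻¹ * E⁻¹ = p * f * A * (q * f * B) / (s * f * D * (t * f * E)) := by
    intro A B D E p q s t f hf hs ht h
    have : p * f * A * (q * f * B) = s * t * (f ^ 2 * (A * B)) := by
      rw [← h]; ring
    rw [this, div_eq_mul_inv]
    simp only [mul_inv]
    field_simp
  exact key _ _ _ _ _ _ _ _ _ hf hp hq hpow

/-! ### Domination for large lower parameters -/

/-- With x = |b+j|, y = |c+j| and m = M+j ≤ x, y, the triangle inequality reduces this to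
(x+y+1)(m-1) ≤ m(x+y) ≤ 2xy. -/
theorem norm_half_add_sub_one_add_natCast_mul_le {b c : ℂ} {M : ℝ} (hM : 3 ≤ M) (hb : M ≤ b.re)
    (hc : M ≤ c.re) (j : ℕ) :
    ‖(b + c - 1) / 2 + j‖ * (M - 1 + j) ≤ ‖b + j‖ * ‖c + j‖ := by
  have hj : (0 : ℝ) ≤ j := j.cast_nonneg
  have hx : M + j ≤ ‖b + j‖ := le_trans (by simpa using hb) (re_le_norm _)
  have hy : M + j ≤ ‖c + j‖ := le_trans (by simpa using hc) (re_le_norm _)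
  have hs : ‖(b + c - 1) / 2 + j‖ ≤ (‖b + j‖ + ‖c + j‖ + 1) / 2 := by
    rw [show (b + c - 1) / 2 + (j : ℂ) = ((b + j) + (c + j) - 1) / 2 by ring, norm_div,
      RCLike.norm_ofNat]
    gcongr
    refine (norm_sub_le _ _).trans ?_
    rw [norm_one]
    gcongr
    exact norm_add_le _ _
  have h0 : 0 ≤ M - 1 + j := by linarith
  refine (mul_le_mul_of_nonneg_right hs h0).trans ?_
  generalize ‖b + j‖ = x at *
  generalize ‖c + j‖ = y at *
  nlinarith [mul_nonneg (sub_nonneg.2 hx) (by linarith : 0 ≤ y),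
    mul_nonneg (sub_nonneg.2 hy) (by linarith : 0 ≤ x)]

/-- Product of the factorwise bounds: j = 0 keeps M-1, while M ≥ 3 gives M-1+j ≥ j+2 for j ≥ 1, and
these multiply to (n+2)!/2. -/
theorem norm_eval_ascPochhammer_succ_mul_le {b c : ℂ} {M : ℝ} (hM : 3 ≤ M) (hb : M ≤ b.re)
    (hc : M ≤ c.re) (n : ℕ) :
    ‖(ascPochhammer ℂ (n + 1)).eval ((b + c - 1) / 2)‖ * ((M - 1) * (n + 2).factorial) ≤
      2 * (‖(ascPochhammer ℂ (n + 1)).eval b‖ * ‖(ascPochhammer ℂ (n + 1)).eval c‖) := by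
  induction n with
  | zero =>
    have := norm_half_add_sub_one_add_natCast_mul_le hM hb hc 0
    simp only [Nat.cast_zero, add_zero, norm_div, RCLike.norm_ofNat] at this
    simp only [zero_add, ascPochhammer_one, Polynomial.eval_X, Nat.factorial_two, Nat.cast_ofNat,
      norm_div, RCLike.norm_ofNat]
    linarith
  | succ n ih =>
    have h := norm_half_add_sub_one_add_natCast_mul_le hM hb hc (n + 1)
    have h' : ‖(b + c - 1) / 2 + (n + 1 : ℕ)‖ * ((n + 3 : ℕ) : ℝ) ≤
        ‖b + (n + 1 : ℕ)‖ * ‖c + (n + 1 : ℕ)‖ := by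
      refine le_trans (mul_le_mul_of_nonneg_left ?_ (norm_nonneg _)) h
      push_cast
      linarith
    rw [ascPochhammer_succ_eval (n + 1), ascPochhammer_succ_eval (n + 1),
      ascPochhammer_succ_eval (n + 1), norm_mul, norm_mul, norm_mul,
      Nat.factorial_succ (n + 2), Nat.cast_mul]
    have := mul_le_mul ih h' (by positivity) (by positivity)
    refine le_trans (le_of_eq ?_) (this.trans (le_of_eq ?_)) <;> ring

theorem whippleTerm_two_one (a : ℂ) (n : ℕ) : whippleTerm a 2 1 n =
    (ascPochhammer ℂ n).eval a * (ascPochhammer ℂ n).eval (1 - a) /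
      (n.factorial * (n + 1).factorial) := by
  have h1 : (ascPochhammer ℂ n).eval 1 = n.factorial := ascPochhammer_eval_one ℂ n
  have h2 : (ascPochhammer ℂ n).eval 2 = (n + 1).factorial := by
    have := mul_eval_ascPochhammer_add_one n 1
    rw [one_mul, h1, one_add_one_eq_two] at this
    rw [this, Nat.factorial_succ]
    push_cast
    ring
  have hf : (n.factorial : ℂ) ≠ 0 := by exact_mod_cast n.factorial_ne_zero
  rw [whippleTerm, show ((2 : ℂ) + 1 - 1) / 2 = 1 by norm_num, h1, h2]
  field_simp

/-- The fixed convergent series with b = 2, c = 1 dominates; the factor 2/(M-1) is at most 1 and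
tends to 0 as M grows. -/
theorem norm_whippleTerm_succ_le (a : ℂ) {b c : ℂ} {M : ℝ} (hM : 3 ≤ M) (hb : M ≤ b.re)
    (hc : M ≤ c.re) (n : ℕ) :
    ‖whippleTerm a b c (n + 1)‖ ≤ 2 / (M - 1) * ‖whippleTerm a 2 1 (n + 1)‖ := by
  have hne : ∀ {x : ℂ}, M ≤ x.re → ∀ k : ℕ, x ≠ -(k : ℂ) := by
    rintro x hx k rfl
    have : (0 : ℝ) ≤ k := k.cast_nonneg
    simp only [neg_re, natCast_re] at hx
    linarith
  have hB := norm_pos_iff.2 (eval_ascPochhammer_ne_zero (hne hb) (n + 1))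
  have hC := norm_pos_iff.2 (eval_ascPochhammer_ne_zero (hne hc) (n + 1))
  have h := norm_eval_ascPochhammer_succ_mul_le hM hb hc n
  have hM1 : 0 < M - 1 := by linarith
  have hf : (0 : ℝ) < (n + 1).factorial := by exact_mod_cast (n + 1).factorial_pos
  have hf2 : (0 : ℝ) < (n + 2).factorial := by exact_mod_cast (n + 2).factorial_pos
  rw [whippleTerm_two_one, whippleTerm]
  simp only [norm_div, norm_mul, norm_natCast]
  rw [div_mul_div_comm, div_le_div_iff₀ (by positivity) (by positivity)]
  have hA : 0 ≤ ‖(ascPochhammer ℂ (n + 1)).eval a‖ *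
      ‖(ascPochhammer ℂ (n + 1)).eval (1 - a)‖ * (n + 1).factorial := by positivity
  have := mul_le_mul_of_nonneg_left h hA
  refine le_trans (le_of_eq ?_) (this.trans (le_of_eq ?_)) <;> ring

theorem tendsto_tsum_whippleTerm_add (a b c : ℂ) :
    Tendsto (fun N : ℕ => ∑' n, whippleTerm a (b + 2 * N) (c + 2 * N) n) atTop (𝓝 1) := by
  have hsum : Summable (whippleTerm a 2 1) := by
    refine summable_whippleTerm a 2 1 (by norm_num) (fun k h => ?_) (fun k h => ?_) <;>
    · have h' := congrArg Complex.re h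
      have : (0 : ℝ) ≤ k := k.cast_nonneg
      simp at h'
      linarith
  have hlim : Tendsto (fun N : ℕ => min b.re c.re + 2 * (N : ℝ)) atTop atTop :=
    tendsto_atTop_add_const_left _ _ (tendsto_natCast_atTop_atTop.const_mul_atTop two_pos)
  have hbound : ∀ᶠ N : ℕ in atTop, ∀ n, ‖whippleTerm a (b + 2 * N) (c + 2 * N) (n + 1)‖ ≤
      2 / (min b.re c.re + 2 * (N : ℝ) - 1) * ‖whippleTerm a 2 1 (n + 1)‖ := by
    filter_upwards [hlim.eventually_ge_atTop 3] with N hN n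
    exact norm_whippleTerm_succ_le a hN (by simp) (by simp) n
  have hsmall : Tendsto (fun N : ℕ => 2 / (min b.re c.re + 2 * (N : ℝ) - 1)) atTop (𝓝 0) :=
    (tendsto_atTop_add_const_right _ (-1) hlim).const_div_atTop 2
  have hone : 1 = ∑' n : ℕ, if n = 0 then (1 : ℂ) else 0 := by simp
  rw [hone]
  -- The term n = 0 is always 1, so it is bounded separately.
  refine tendsto_tsum_of_dominated_convergence (bound := fun n =>
    if n = 0 then 1 else ‖whippleTerm a 2 1 n‖) ?_ ?_ ?_
  · rw [← summable_nat_add_iff 1]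
    simpa using (summable_nat_add_iff 1).2 hsum.norm
  · rintro (_ | n)
    · simp [whippleTerm]
    · simp only [Nat.succ_ne_zero, if_false]
      have := hsmall.mul_const ‖whippleTerm a 2 1 (n + 1)‖
      rw [zero_mul] at this
      exact squeeze_zero_norm' (hbound.mono fun N h => h n) this
  · filter_upwards [hbound, hlim.eventually_ge_atTop 3] with N h hN
    rintro (_ | n)
    · simp [whippleTerm]
    · simp only [Nat.succ_ne_zero, if_false]
      refine (h n).trans (mul_le_of_le_one_left (norm_nonneg _) ?_)
      rw [div_le_one (by linarith)]
      linarith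

theorem mainTheorem6 (a b c : ℂ) (hbc : 1 < (b + c).re)
    (hb : ∀ k : ℕ, b ≠ -(k : ℂ)) (hc : ∀ k : ℕ, c ≠ -(k : ℂ)) :
    Summable (hypergeometricTerm [a, 1 - a, (b + c - 1) / 2] [b, c] 1) ∧
    generalizedHypergeometric [a, 1 - a, (b + c - 1) / 2] [b, c] 1 =
      (4 * (Real.pi : ℂ) * (2 : ℂ) ^ (-(b + c)) * Complex.Gamma b * Complex.Gamma c) /
        (Complex.Gamma ((b + a) / 2) * Complex.Gamma ((b + (1 - a)) / 2) *
          Complex.Gamma ((c + a) / 2) * Complex.Gamma ((c + (1 - a)) / 2)) := by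
  rw [generalizedHypergeometric, hypergeometricTerm_eq_whippleTerm]
  refine ⟨summable_whippleTerm a b c hbc hb hc, ?_⟩
  have t := ((tendsto_whippleFactor a b hb).mul (tendsto_whippleFactor a c hc)).mul
    (tendsto_tsum_whippleTerm_add a b c)
  have h := tendsto_nhds_unique (tendsto_const_nhds.congr
    (tsum_whippleTerm_eq_mul a b c hbc hb hc)) t
  -- Each of the two factor limits contributes one √π and one power of 2.
  have hpi : ((√Real.pi : ℝ) : ℂ) * (√Real.pi : ℝ) = Real.pi := by
    rw [← ofReal_mul, Real.mul_self_sqrt Real.pi_pos.le]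
  have hpow : (2 : ℂ) ^ (1 - b) * (2 : ℂ) ^ (1 - c) = 4 * (2 : ℂ) ^ (-(b + c)) := by
    rw [← cpow_add _ _ two_ne_zero, show 1 - b + (1 - c) = (2 : ℕ) + -(b + c) by push_cast; ring,
      cpow_add _ _ two_ne_zero, cpow_natCast]
    norm_num
  rw [h, mul_one, div_mul_div_comm]
  congr 1
  · linear_combination Gamma b * Gamma c * (2 : ℂ) ^ (1 - b) * (2 : ℂ) ^ (1 - c) * hpi +
      Gamma b * Gamma c * Real.pi * hpow
  · ring
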